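/- Let $D_{28}^+\subset\mathbb{Q}^{28}$ be the integral lattice of all vectors $x$ whose coordinates lie all in $\mathbb{Z}$ or all in $\mathbb{Z}+\tfrac12$ and satisfy $\sum_i x_i\in 2\mathbb{Z}$, with the standard bilinear form. Let $V=V_{D_{28}^+}=S(\mathfrak{h}\otimes t^{-1}\mathbb{C}[t^{-1}])\otimes\mathbb{C}[D_{28}^+]$, $\mathfrak{h}=\mathbb{C}\otimes_{\mathbb{Z}} D_{28}^+=\mathbb{C}^{28}$, be the associated lattice super vertex operator algebra, of rank $c=28$. Here $Y(e^\alpha,z)=\exp\big(\sum_{n>0}\alpha(-n)\tfrac{z^{n}}{n}\big)\exp\big(-\sum_{n>0}\alpha(n)\tfrac{z^{-n}}{n}\big)e_\alpha z^{\alpha(0)}$, where $e_\alpha e^\beta=\varepsilon(\alpha,\beta)e^{\alpha+\beta}$ for a bimultiplicative $\varepsilon$ with values $\pm1$ and $\varepsilon(\alpha,\beta)\varepsilon(\beta,\alpha)=(-1)^{\langle\alpha,\beta\rangle+\langle\alpha,\alpha\rangle\langle\beta,\beta\rangle}$, and the vertex operators of the other vectors are the usual normally ordered products. $V$ is the super vertex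 operator algebra underlying the enhanced super vertex operator algebra $A_{Ru}$ of the Rudvalis group. With the standard orthonormal basis $h_1,\dots,h_{28}$ of $\mathfrak{h}$, let $\omega=\tfrac12\sum_ih_i(-1)^2\otimes e^0$ be the conformal element, let $\jmath=\sum_ih_i(-1)\otimes e^0$ be the conformal generator of degree $1$ that defines the charge, and let $L(0)$ and $J(0)$ be given by $Y(\omega,z)=\sum_n L(n)z^{-n-2}$ and $Y(\jmath,z)=\sum_n J(n)z^{-n-1}$. Then $J(0)$ and $L(0)$ commute, and $V=\bigoplus_{m\in\mathbb{Z},\,n\in\frac12\mathbb{Z}}V_{m,n}$, where $V_{m,n}$ is the space of vectors $v$ with $J(0)v=mv$ and $L(0)v=nv$, and every $V_{m,n}$ has finite dimension. Moreover, for all $z,\tau\in\mathbb{C}$ with $\operatorname{Im}\tau>0$, with the conventions $p^a=e^{2\pi i a z}$ and $q^a=e^{2\pi i a\tau}$, the character $$\operatorname{tr}|_{A_{Ru}}\,p^{J(0)}q^{L(0)-c/24}=\sum_{m\in\mathbb{Z},\;n\in\frac12\mathbb{Z}}\dim(V_{m,n})\,p^m q^{\,n-28/24}$$ converges absolutely and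 equals $$\frac12\left(\frac{\vartheta_3(\pi z|\tau)^{28}}{\eta(\tau)^{28}}+\frac{\vartheta_3(\pi z+\pi/2|\tau)^{28}}{\eta(\tau)^{28}}\right)+\frac12\,p^{14}q^{7/2}\left(\frac{\vartheta_3(\pi z+\pi\tau/2|\tau)^{28}}{\eta(\tau)^{28}}+\frac{\vartheta_3(\pi z+\pi\tau/2+\pi/2|\tau)^{28}}{\eta(\tau)^{28}}\right),$$ where $\vartheta_3(z|\tau)=\sum_{m\in\mathbb{Z}}e^{2izm+\pi i\tau m^2}$ and $\eta(\tau)=q^{1/24}\prod_{m\ge1}(1-q^m)$. -/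

import Mathlib

open Complex

noncomputable section

namespace LatticeSVOA

/-! ### The lattice `D₂₈⁺` -/

/-- The standard symmetric bilinear form on `ℚ²⁸`. -/
def form (x y : Fin 28 → ℚ) : ℚ := ∑ i, x i * y i

/-- The lattice `D₂₈⁺`: the vectors of `ℚ²⁸` whose coordinates are all in `ℤ` or all in `ℤ + 1/2`,
and whose coordinate sum is an even integer. -/
def D28Plus : AddSubgroup (Fin 28 → ℚ) where
  carrier := {x | ((∀ i, ∃ n : ℤ, x i = n) ∨ (∀ i, ∃ n : ℤ, x i = n + 1 / 2)) ∧
    ∃ k : ℤ, ∑ i, x i = 2 * k}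
  zero_mem' := ⟨Or.inl fun _ => ⟨0, by simp⟩, 0, by simp⟩
  add_mem' := by
    rintro x y ⟨hx, k, hk⟩ ⟨hy, l, hl⟩
    refine ⟨?_, k + l, by simp only [Pi.add_apply, Finset.sum_add_distrib, hk, hl]; push_cast; ring⟩
    rcases hx with hx | hx <;> rcases hy with hy | hy
    · left; intro i; obtain ⟨a, ha⟩ := hx i; obtain ⟨b, hb⟩ := hy i
      exact ⟨a + b, by simp [ha, hb]⟩
    · right; intro i; obtain ⟨a, ha⟩ := hx i; obtain ⟨b, hb⟩ := hy i
      exact ⟨a + b, by simp [ha, hb]; ring⟩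
    · right; intro i; obtain ⟨a, ha⟩ := hx i; obtain ⟨b, hb⟩ := hy i
      exact ⟨a + b, by simp [ha, hb]; ring⟩
    · left; intro i; obtain ⟨a, ha⟩ := hx i; obtain ⟨b, hb⟩ := hy i
      exact ⟨a + b + 1, by simp [ha, hb]; ring⟩
  neg_mem' := by
    rintro x ⟨hx, k, hk⟩
    refine ⟨?_, -k, by simp [hk]⟩
    rcases hx with hx | hx
    · left; intro i; obtain ⟨a, ha⟩ := hx i
      exact ⟨-a, by simp [ha]⟩
    · right; intro i; obtain ⟨a, ha⟩ := hx i
      exact ⟨-a - 1, by simp [ha]; ring⟩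

/-- The integer `⟨α, β⟩`. -/
def pairing (α β : D28Plus) : ℤ := ⌊form α β⌋

/-- Coordinates `(a, d)` of a lattice vector `α = (a / 2) (1, …, 1) + d`, where `a = 2 α₀`
and `dᵢ = αᵢ - α₀`: these are integers and `∑ dᵢ` is even. -/
def coordA (α : D28Plus) : ℤ := ⌊2 * α.1 0⌋

/-- The integers `dᵢ = αᵢ - α₀`. -/
def coordD (α : D28Plus) (i : Fin 28) : ℤ := ⌊α.1 i - α.1 0⌋

/-- An integral bilinear form `B` on `D₂₈⁺` such that
`B(α, β) + B(β, α) ≡ ⟨α, β⟩ + ⟨α, α⟩ ⟨β, β⟩` modulo `2`. -/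
def cocycleExponent (α β : D28Plus) : ℤ :=
  coordA α * ((∑ i, coordD β i) / 2) +
    ∑ i, ∑ j, if j < i then coordD α i * coordD β j else 0

/-- The `2`-cocycle `ε : D₂₈⁺ × D₂₈⁺ → {±1}`, `ε(α, β) = (-1) ^ B(α, β)`. -/
def cocycle (α β : D28Plus) : ℤˣ := (-1 : ℤˣ) ^ cocycleExponent α β

theorem coordA_cast (α : D28Plus) : (coordA α : ℚ) = 2 * α.1 0 := by
  obtain ⟨α, hα, -⟩ := α
  rcases hα with h | h <;> obtain ⟨n, hn⟩ := h 0
  · have : (2 * α 0 : ℚ) = ((2 * n : ℤ) : ℚ) := by rw [hn]; push_cast; ring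
    simp only [coordA, this, Int.floor_intCast]
  · have : (2 * α 0 : ℚ) = ((2 * n + 1 : ℤ) : ℚ) := by rw [hn]; push_cast; ring
    simp only [coordA, this, Int.floor_intCast]

theorem coordD_cast (α : D28Plus) (i : Fin 28) : (coordD α i : ℚ) = α.1 i - α.1 0 := by
  obtain ⟨α, hα, -⟩ := α
  rcases hα with h | h <;> obtain ⟨n, hn⟩ := h 0 <;> obtain ⟨m, hm⟩ := h i
  all_goals
    have : (α i - α 0 : ℚ) = ((m - n : ℤ) : ℚ) := by rw [hn, hm]; push_cast; ring
    simp only [coordD, this, Int.floor_intCast]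

/-- The integers `dᵢ` have an even sum. -/
theorem sum_coordD (α : D28Plus) : ∃ e : ℤ, ∑ i, coordD α i = 2 * e ∧
    (2 * e : ℚ) = ∑ i, α.1 i - 28 * α.1 0 := by
  obtain ⟨k, hk⟩ := α.2.2
  have h : ((∑ i, coordD α i : ℤ) : ℚ) = ∑ i, α.1 i - 28 * α.1 0 := by
    push_cast
    simp only [coordD_cast, Finset.sum_sub_distrib]
    simp
  refine ⟨k - 7 * coordA α, ?_, ?_⟩
  · have : ((∑ i, coordD α i : ℤ) : ℚ) = ((2 * (k - 7 * coordA α) : ℤ) : ℚ) := by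
      rw [h, hk]; push_cast; rw [coordA_cast]; ring
    exact_mod_cast this
  · rw [hk]; push_cast; rw [coordA_cast]; ring

/-- The form of `D₂₈⁺` in the coordinates `(a, d)`. -/
theorem form_eq (α β : D28Plus) : form α β =
    ((7 * coordA α * coordA β + coordA α * ((∑ i, coordD β i) / 2) +
      coordA β * ((∑ i, coordD α i) / 2) + ∑ i, coordD α i * coordD β i : ℤ) : ℚ) := by
  obtain ⟨e, he, he'⟩ := sum_coordD α
  obtain ⟨f, hf, hf'⟩ := sum_coordD β
  rw [he, hf, Int.mul_ediv_cancel_left _ two_ne_zero, Int.mul_ediv_cancel_left _ two_ne_zero]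
  push_cast
  simp only [coordD_cast, coordA_cast, form]
  have : ∑ i, (α.1 i - α.1 0) * (β.1 i - β.1 0) = ∑ i, α.1 i * β.1 i - α.1 0 * ∑ i, β.1 i
      - β.1 0 * ∑ i, α.1 i + 28 * (α.1 0 * β.1 0) := by
    simp only [sub_mul, mul_sub, Finset.sum_sub_distrib, ← Finset.mul_sum, ← Finset.sum_mul]
    simp
    ring
  rw [this]
  linear_combination (-α.1 0) * hf' - (β.1 0) * he'

/-- `D₂₈⁺` is an integral lattice. -/
theorem pairing_cast (α β : D28Plus) : (pairing α β : ℚ) = form α β := by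
  rw [pairing, form_eq, Int.floor_intCast]

theorem coordA_add (α β : D28Plus) : coordA (α + β) = coordA α + coordA β := by
  have : ((coordA (α + β) : ℤ) : ℚ) = ((coordA α + coordA β : ℤ) : ℚ) := by
    push_cast; simp only [coordA_cast, AddSubgroup.coe_add, Pi.add_apply]; ring
  exact_mod_cast this

theorem coordD_add (α β : D28Plus) (i : Fin 28) :
    coordD (α + β) i = coordD α i + coordD β i := by
  have : ((coordD (α + β) i : ℤ) : ℚ) = ((coordD α i + coordD β i : ℤ) : ℚ) := by
    push_cast; simp only [coordD_cast, AddSubgroup.coe_add, Pi.add_apply]; ring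
  exact_mod_cast this

/-- `ε` is bimultiplicative, hence a `2`-cocycle. -/
theorem cocycle_add_left (α β γ : D28Plus) :
    cocycle (α + β) γ = cocycle α γ * cocycle β γ := by
  rw [cocycle, cocycle, cocycle, ← zpow_add]
  congr 1
  simp only [cocycleExponent, coordA_add, coordD_add, add_mul]
  rw [add_add_add_comm, ← Finset.sum_add_distrib]
  congr 1
  refine Finset.sum_congr rfl fun i _ => ?_
  rw [← Finset.sum_add_distrib]
  exact Finset.sum_congr rfl fun j _ => by split_ifs <;> simp

theorem cocycle_add_right (α β γ : D28Plus) :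
    cocycle α (β + γ) = cocycle α β * cocycle α γ := by
  rw [cocycle, cocycle, cocycle, ← zpow_add]
  congr 1
  obtain ⟨e, he, -⟩ := sum_coordD β
  obtain ⟨f, hf, -⟩ := sum_coordD γ
  simp only [cocycleExponent, coordD_add, mul_add, Finset.sum_add_distrib, he, hf]
  rw [← mul_add, Int.mul_ediv_cancel_left _ two_ne_zero, Int.mul_ediv_cancel_left _ two_ne_zero,
    Int.mul_ediv_cancel_left _ two_ne_zero, mul_add, add_add_add_comm, ← Finset.sum_add_distrib]
  congr 1
  refine Finset.sum_congr rfl fun i _ => ?_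
  rw [← Finset.sum_add_distrib]
  exact Finset.sum_congr rfl fun j _ => by split_ifs <;> simp

/-- The commutator of `ε` is the one required for the lattice SVOA of an integral lattice. -/
theorem cocycle_comm (α β : D28Plus) : cocycle α β * cocycle β α =
    (-1 : ℤˣ) ^ (pairing α β + pairing α α * pairing β β) := by
  have hp : ∀ γ δ : D28Plus, pairing γ δ =
      7 * coordA γ * coordA δ + coordA γ * ((∑ i, coordD δ i) / 2) +
      coordA δ * ((∑ i, coordD γ i) / 2) + ∑ i, coordD γ i * coordD δ i := fun γ δ => by
    rw [pairing, form_eq, Int.floor_intCast]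
  have hB : cocycleExponent α β + cocycleExponent β α =
      coordA α * ((∑ i, coordD β i) / 2) + coordA β * ((∑ i, coordD α i) / 2) +
      (∑ i, coordD α i) * (∑ i, coordD β i) - ∑ i, coordD α i * coordD β i := by
    have h1 : ∑ i, ∑ j, (if j < i then coordD β i * coordD α j else 0) =
        ∑ i, ∑ j, (if i < j then coordD α i * coordD β j else 0) := by
      rw [Finset.sum_comm]
      simp only [mul_comm]
    have h2 : (∑ i, coordD α i) * (∑ i, coordD β i) - ∑ i, coordD α i * coordD β i =
        ∑ i, ∑ j, ((if j < i then coordD α i * coordD β j else 0) +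
          (if i < j then coordD α i * coordD β j else 0)) := by
      rw [Finset.sum_mul_sum, ← Finset.sum_sub_distrib]
      refine Finset.sum_congr rfl fun i _ => ?_
      have h3 : coordD α i * coordD β i =
          ∑ j, if i = j then coordD α i * coordD β j else 0 := by simp
      rw [h3, ← Finset.sum_sub_distrib]
      refine Finset.sum_congr rfl fun j _ => ?_
      rcases lt_trichotomy i j with h | h | h
      · simp [h, h.ne, h.not_gt]
      · simp [h]
      · simp [h, h.ne', h.not_gt]
    simp only [Finset.sum_add_distrib] at h2
    rw [cocycleExponent, cocycleExponent, h1, add_sub_assoc, h2]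
    ring
  have hsq : ∀ γ : D28Plus, Even (pairing γ γ - coordA γ) := fun γ => by
    obtain ⟨e, he, -⟩ := sum_coordD γ
    have h4 : Even (∑ i, (coordD γ i * coordD γ i - coordD γ i)) :=
      Finset.even_sum _ fun i _ => by
        have := Int.even_mul_pred_self (coordD γ i)
        rwa [mul_sub, mul_one] at this
    obtain ⟨r, hr⟩ := h4
    rw [Finset.sum_sub_distrib, he] at hr
    obtain ⟨t, ht⟩ := Int.even_mul_pred_self (coordA γ)
    refine ⟨3 * coordA γ * coordA γ + t + coordA γ * e + r + e, ?_⟩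
    rw [hp, he, Int.mul_ediv_cancel_left _ two_ne_zero]
    linear_combination ht + hr
  obtain ⟨r, hr⟩ := hsq α
  obtain ⟨t, ht⟩ := hsq β
  obtain ⟨e, he, -⟩ := sum_coordD α
  rw [cocycle, cocycle, ← zpow_add, ← mul_inv_eq_one, ← zpow_neg, ← zpow_add]
  refine Even.neg_one_zpow ?_
  refine ⟨e * (∑ i, coordD β i) - ∑ i, coordD α i * coordD β i - 4 * coordA α * coordA β
    - r * coordA β - t * coordA α - 2 * r * t, ?_⟩
  rw [hB, hp α β, eq_add_of_sub_eq hr, eq_add_of_sub_eq ht, he]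
  ring

/-! ### The underlying space -/

/-- Labels `(i, n)` of the creation operators `εᵢ(-n)`, `n ≥ 1`, where `ε₀, …, ε₂₇` is the standard
orthonormal basis of `𝔥 = ℂ ⊗ D₂₈⁺ = ℂ²⁸`. -/
abbrev Osc : Type := Fin 28 × ℕ+

/-- The Fock space `S(𝔥 ⊗ t⁻¹ ℂ[t⁻¹])`: polynomials in the variables `X (i, n) = εᵢ(-n)`. -/
abbrev Fock : Type := MvPolynomial Osc ℂ

/-- The space `V = S(𝔥 ⊗ t⁻¹ ℂ[t⁻¹]) ⊗ ℂ[D₂₈⁺]` of the lattice SVOA of `D₂₈⁺`, which is the SVOA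
underlying the enhanced SVOA `A_Ru`; `Finsupp.single α P` is the vector `P ⊗ e^α`. It is even for
`⟨α, α⟩` even and odd for `⟨α, α⟩` odd. -/
abbrev V : Type := D28Plus →₀ Fock

/-- The `ℂ`-algebra structure on Laurent series by scalars acting on coefficients (fixed here among
the propositionally equal instances). -/
instance laurentAlgebra : Algebra ℂ (LaurentSeries Fock) := HahnSeries.instAlgebra

/-! ### Vertex operators

For a monomial `u = ε_{i₁}(-m₁) ⋯ ε_{iₖ}(-mₖ) ⊗ e^α`, the vertex operator `Y(u, z)` is the normally
ordered product `: ∂^{(m₁-1)} ε_{i₁}(z) ⋯ ∂^{(mₖ-1)} ε_{iₖ}(z) Y(e^α, z) :`, where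
`∂^{(r)} = (1 / r!) (d / dz)^r`, `εᵢ(z) = ∑ₙ εᵢ(n) z^{-n-1}`, and
`Y(e^α, z) = exp(∑_{n>0} α(-n) zⁿ / n) exp(-∑_{n>0} α(n) z⁻ⁿ / n) e_α z^{α(0)}`.
Here `εᵢ(-n)` is multiplication by `X (i, n)` and `εᵢ(n)` is `n ∂/∂X (i, n)` for `n > 0`, `εᵢ(0)` acts
on `P ⊗ e^β` as the scalar `βᵢ`, and `e_α (P ⊗ e^β) = ε(α, β) P ⊗ e^{α+β}`. -/

/-- The coefficient of `εᵢ(n) z^{-n-m}` in `∂^{(m-1)} εᵢ(z)`, that is, the binomial coefficient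
`-n-1` over `m-1`. -/
def fieldCoeff (n : ℤ) (m : ℕ+) : ℂ := (Ring.choose (-n - 1) ((m : ℕ) - 1) : ℤ)

/-- The part of `∂^{(m-1)} εᵢ(z)` made of the creation operators `εᵢ(-n)`, `n > 0`, as a Laurent
series with coefficients in the Fock space (it acts by multiplication). As the coefficient of
`εᵢ(-n) z^{n-m}` vanishes for `0 < n < m`, only `n = m + j` with `j ≥ 0` occurs. -/
def creationField (a : Osc) : LaurentSeries Fock :=
  HahnSeries.ofPowerSeries ℤ Fock (PowerSeries.mk fun j : ℕ =>
    MvPolynomial.C (fieldCoeff (-((a.2 : ℤ) + j)) a.2) *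
      MvPolynomial.X (a.1, ⟨a.2 + j, by positivity⟩))

/-- The part of `∂^{(m-1)} εᵢ(z)` made of the annihilation operators `εᵢ(n) = n ∂/∂X (i, n)`,
`n > 0`: a derivation, linear over the Laurent series. -/
def annihilationField (a : Osc) :
    Derivation (LaurentSeries Fock) (MvPolynomial Osc (LaurentSeries Fock))
      (MvPolynomial Osc (LaurentSeries Fock)) :=
  MvPolynomial.mkDerivation (LaurentSeries Fock) fun b : Osc =>
    if b.1 = a.1 then
      MvPolynomial.C (HahnSeries.single (-(b.2 : ℤ) - a.2)
        (MvPolynomial.C (fieldCoeff b.2 a.2 * (b.2 : ℂ))))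
    else 0

/-- The part of `∂^{(m-1)} εᵢ(z)` containing `εᵢ(0)`, as it acts on `S(𝔥 ⊗ t⁻¹ ℂ[t⁻¹]) ⊗ e^β`. -/
def zeroModeField (β : D28Plus) (a : Osc) : LaurentSeries Fock :=
  HahnSeries.single (-(a.2 : ℤ)) (MvPolynomial.C (fieldCoeff 0 a.2 * ((β.1 a.1 : ℚ) : ℂ)))

/-- The field `∂^{(m-1)} εᵢ(z)` acting on vectors over `e^β`, prepared for normal ordering: its
annihilation part acts on the polynomial variables, whereas its creation part acts on the
coefficients, which no annihilation operator sees. -/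
def orderedField (β : D28Plus) (a : Osc) :
    Module.End (LaurentSeries Fock) (MvPolynomial Osc (LaurentSeries Fock)) :=
  (annihilationField a).toLinearMap +
    algebraMap (LaurentSeries Fock) _ (creationField a + zeroModeField β a)

theorem orderedField_commute (β : D28Plus) (a b : Osc) :
    Commute (orderedField β a) (orderedField β b) := by
  have hX : ∀ a b c : Osc,
      annihilationField a (annihilationField b (MvPolynomial.X c)) = 0 := fun a b c => by
    simp only [annihilationField, MvPolynomial.mkDerivation_X]
    split_ifs
    · exact MvPolynomial.derivation_C _ _
    · exact map_zero _
  have h' : Commute (annihilationField a).toLinearMap (annihilationField b).toLinearMap := by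
    refine LinearMap.ext fun p => ?_
    change annihilationField a (annihilationField b p) = annihilationField b (annihilationField a p)
    induction p using MvPolynomial.induction_on with
    | C r => simp only [MvPolynomial.derivation_C, map_zero]
    | add p q hp hq => simp only [map_add, hp, hq]
    | mul_X p c hp =>
      simp only [Derivation.leibniz, map_add, smul_eq_mul, hX, hp, mul_zero, zero_add]
      ring
  unfold orderedField
  refine Commute.add_left (Commute.add_right h' ?_) ?_
  · exact (Algebra.commutes _ _).symm
  · exact Algebra.commutes _ _

theorem pairwise_commute_orderedField (β : D28Plus) (s : Multiset Osc) :
    {x | x ∈ s.map (orderedField β)}.Pairwise Commute := by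
  intro x hx y hy _
  obtain ⟨a, -, rfl⟩ := Multiset.mem_map.1 hx
  obtain ⟨b, -, rfl⟩ := Multiset.mem_map.1 hy
  exact orderedField_commute β a b

/-- The product of the fields `∂^{(m-1)} εᵢ(z)` over the factors `εᵢ(-m)` of a monomial, prepared for
normal ordering. -/
def orderedProduct (β : D28Plus) (s : Osc →₀ ℕ) :
    Module.End (LaurentSeries Fock) (MvPolynomial Osc (LaurentSeries Fock)) :=
  ((Finsupp.toMultiset s).map (orderedField β)).noncommProd
    (pairwise_commute_orderedField β (Finsupp.toMultiset s))

/-- `exp(∑_{n>0} α(-n) zⁿ / n)`. -/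
def expCreation (α : D28Plus) : LaurentSeries Fock :=
  HahnSeries.ofPowerSeries ℤ Fock ((PowerSeries.exp ℚ).subst (PowerSeries.mk fun n : ℕ =>
    if h : 0 < n then
      ∑ i, MvPolynomial.C (((α.1 i : ℚ) : ℂ) / n) * MvPolynomial.X (i, ⟨n, h⟩)
    else (0 : Fock)))

/-- `exp(-∑_{n>0} α(n) z⁻ⁿ / n)` with `α(n) = ∑ᵢ αᵢ n ∂/∂X (i, n)`, that is, the translation
`X (i, n) ↦ X (i, n) - αᵢ z⁻ⁿ`. -/
def expAnnihilation (α : D28Plus) :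
    MvPolynomial Osc (LaurentSeries Fock) →ₐ[LaurentSeries Fock] LaurentSeries Fock :=
  MvPolynomial.aeval fun b : Osc =>
    HahnSeries.C (MvPolynomial.X b) -
      HahnSeries.single (-(b.2 : ℤ)) (MvPolynomial.C ((α.1 b.1 : ℚ) : ℂ))

/-- `Q ↦ Y(u, z) (Q ⊗ e^β)` for the monomial `u = X^s ⊗ e^α`, with the factor `e^{α+β}` of the result
omitted. -/
def vertexMonomial (α β : D28Plus) (s : Osc →₀ ℕ) : Fock →ₗ[ℂ] LaurentSeries Fock :=
  LinearMap.mulLeft ℂ (HahnSeries.single (pairing α β) ((cocycle α β : ℤ) : Fock) * expCreation α) ∘ₗ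
    (expAnnihilation α).toLinearMap.restrictScalars ℂ ∘ₗ
    (orderedProduct β s).restrictScalars ℂ ∘ₗ
    (MvPolynomial.aeval (R := ℂ) fun b : Osc =>
      (MvPolynomial.X b : MvPolynomial Osc (LaurentSeries Fock))).toLinearMap

/-- The modes `u ↦ v ↦ u₍ₙ₎ v` of the vertex operators `Y(u, z) v = ∑ₙ u₍ₙ₎ v z^{-n-1}`, extended
bilinearly from monomials `u = X^s ⊗ e^α` and vectors `v = Q ⊗ e^β`. -/
def mode (n : ℤ) : V →ₗ[ℂ] V →ₗ[ℂ] V :=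
  Finsupp.lsum ℂ fun α => (MvPolynomial.basisMonomials Osc ℂ).constr ℂ fun s =>
    Finsupp.lsum ℂ fun β =>
      Finsupp.lsingle (α + β) ∘ₗ HahnSeries.coeff.linearMap (-n - 1) ∘ₗ vertexMonomial α β s

/-! ### Vacuum, conformal element, charge -/

/-- The vacuum vector `1 ⊗ e⁰`. -/
def vacuum : V := Finsupp.single 0 1

/-- The conformal element `ω = (1/2) ∑ᵢ εᵢ(-1)² ⊗ e⁰`, of central charge (rank) `c = 28`. -/
def conformal : V :=
  Finsupp.single 0 (MvPolynomial.C (1 / 2) * ∑ i : Fin 28, MvPolynomial.X (i, 1) ^ 2)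

/-- The conformal generator `ȷ = ∑ᵢ εᵢ(-1) ⊗ e⁰`, of degree one, that defines the charge. -/
def current : V := Finsupp.single 0 (∑ i : Fin 28, MvPolynomial.X (i, 1))

/-- The Virasoro operators: `Y(ω, z) = ∑ₙ L(n) z^{-n-2}`. -/
def L (n : ℤ) : Module.End ℂ V := mode (n + 1) conformal

/-- The modes `Y(ȷ, z) = ∑ₙ J(n) z^{-n-1}`; in particular `J(0)` is the residue of `Y(ȷ, z)`. -/
def J (n : ℤ) : Module.End ℂ V := mode n current

/-- The space of vectors of charge `m` and degree `k / 2`. -/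
def homogeneous (m k : ℤ) : Submodule ℂ V :=
  (J 0).eigenspace (m : ℂ) ⊓ (L 0).eigenspace ((k : ℂ) / 2)

/-! ### The theta function -/

/-- Jacobi's theta function `ϑ₃(z|τ) = ∑_{m ∈ ℤ} exp(2 i z m + π i τ m²)`. -/
def theta3 (z τ : ℂ) : ℂ := ∑' m : ℤ, exp (2 * I * z * m + Real.pi * I * τ * m ^ 2)

/-- Comparison with Mathlib's normalization. -/
theorem theta3_eq (z τ : ℂ) : theta3 z τ = jacobiTheta₂ (z / Real.pi) τ := by
  refine tsum_congr fun m => ?_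
  have : (Real.pi : ℂ) ≠ 0 := ofReal_ne_zero.2 Real.pi_ne_zero
  rw [jacobiTheta₂_term]
  congr 1
  field_simp

end LatticeSVOA

end

open Complex

noncomputable section

namespace LatticeSVOA

/-! ### Sums over products -/

section Sums

variable {𝕜 : Type*} [NormedField 𝕜] [CompleteSpace 𝕜]

/-! The vectors `X^s ⊗ e^β` form a basis of `V` that diagonalises both `J 0` and `L 0`. For `α = 0`
both exponentials and the cocycle in the vertex operator are trivial, so only normally ordered
products of the fields `εᵢ(z)` remain. In the residue of `Y(ȷ, z)` only the zero modes survive, with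
eigenvalue `∑ βᵢ` (`J_zero_single`). In the `z⁻²` coefficient of `Y(ω, z)` the square of the zero
mode gives `⟨β, β⟩ / 2`, and the products `εᵢ(-n) εᵢ(n)` give the Euler operator that measures the
weight of `s` (`L_zero_single`).

Hence `homogeneous m k` is spanned by the basis vectors of bidegree `(m, k)` (`homogeneous_eq`), and
the character is the sum of `p^m q^(k/2 - 28/24)` over the basis, collected along the fibres of
`bidegree`. As the basis is indexed by pairs `(β, s)`, this sum factors. The Fock factor is the
generating function of monomials, `∏ (1 - qⁿ)⁻²⁸` (`hasSum_pow_weight`). The lattice factor is the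
theta series of `D₂₈⁺` (`hasSum_lattice`): the lattice is the union of the even integer vectors and
their translate by `(1/2, …, 1/2)`, and evenness of the sum is imposed by averaging over the sign
`(-1)^(∑ mᵢ)`, which is a shift of the theta argument by `π / 2`. -/

theorem summable_hasSum_mul {ι κ : Type*} {g : ι → 𝕜} {h : κ → 𝕜} {a b : 𝕜}
    (hg : Summable fun x => ‖g x‖) (hh : Summable fun x => ‖h x‖)
    (ha : HasSum g a) (hb : HasSum h b) :
    (Summable fun x : ι × κ => ‖g x.1 * h x.2‖) ∧
      HasSum (fun x : ι × κ => g x.1 * h x.2) (a * b) :=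
  have hs := hg.mul_norm hh
  ⟨hs, ha.mul hb hs.of_norm⟩

/-- Induction splitting off the first coordinate. Summability of the norms is carried along because
the product of two series at the next step requires it. -/
theorem summable_hasSum_fin_pi_prod {ι : Type*} (n : ℕ) (f : Fin n → ι → 𝕜)
    (hf : ∀ i, Summable fun a => ‖f i a‖) :
    (Summable fun m : Fin n → ι => ‖∏ i, f i (m i)‖) ∧
      HasSum (fun m : Fin n → ι => ∏ i, f i (m i)) (∏ i, ∑' a, f i a) := by
  induction n with
  | zero =>
    refine ⟨(hasSum_fintype _).summable, ?_⟩
    simp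
  | succ n ih =>
    have h0 : Summable fun a => ‖f 0 a‖ := hf 0
    have hf' : ∀ i : Fin n, Summable fun a => ‖f i.succ a‖ := fun i => hf i.succ
    have h1 := (ih (fun i => f i.succ) hf').1
    have h2 := (ih (fun i => f i.succ) hf').2
    have hs := summable_hasSum_mul h0 h1 h0.of_norm.hasSum h2
    have hp : ∀ x : ι × (Fin n → ι), ∏ i, f i (Fin.consEquiv (fun _ => ι) x i) =
        f 0 x.1 * ∏ i, f i.succ (x.2 i) := fun x => by
      simp [Fin.prod_univ_succ, Fin.consEquiv]
    rw [← (Fin.consEquiv (fun _ => ι)).summable_iff, ← (Fin.consEquiv (fun _ => ι)).hasSum_iff,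
      Fin.prod_univ_succ]
    simpa only [Function.comp_def, hp] using hs

theorem hasSum_pi_prod {κ ι : Type*} [Fintype κ] (f : κ → ι → 𝕜)
    (hf : ∀ i, Summable fun a => ‖f i a‖) :
    HasSum (fun m : κ → ι => ∏ i, f i (m i)) (∏ i, ∑' a, f i a) := by
  let e := Fintype.equivFin κ
  have h := (summable_hasSum_fin_pi_prod _ (fun i => f (e.symm i)) fun i => hf _).2
  rw [e.symm.prod_comp (fun i => ∑' a, f i a)] at h
  rw [← (e.symm.arrowCongr (Equiv.refl ι)).hasSum_iff]
  convert h using 1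
  funext m
  simp only [Function.comp_apply, Equiv.arrowCongr_apply, Equiv.symm_symm, Equiv.coe_refl, id]
  rw [← e.symm.prod_comp]
  simp

/-- Monomials supported in `T` are functions `T → ℕ`, so this is a finite product of geometric
series. The indicator keeps all the sums over one index type, as dominated convergence in `T` needs.
-/
theorem hasSum_finsupp_support_subset {ι : Type*} (x : ι → 𝕜) (hx : ∀ b, ‖x b‖ < 1)
    (T : Finset ι) :
    HasSum ({s : ι →₀ ℕ | (s.support : Set ι) ⊆ T}.indicator fun s => s.prod fun b k => x b ^ k)
      (∏ b ∈ T, (1 - x b)⁻¹) := by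
  rw [← hasSum_subtype_iff_indicator]
  let e : {s : ι →₀ ℕ | (s.support : Set ι) ⊆ T} ≃ (↥(T : Set ι) → ℕ) :=
    (Finsupp.restrictSupportEquiv (T : Set ι) ℕ).trans
      (Finsupp.equivFunOnFinite (α := (T : Set ι)))
  rw [← e.symm.hasSum_iff]
  have h := hasSum_pi_prod (fun (b : (T : Set ι)) (k : ℕ) => x b ^ k) fun b => by
    simpa using summable_geometric_of_lt_one (norm_nonneg _) (hx b)
  simp only [tsum_geometric_of_norm_lt_one (hx _)] at h
  rw [← Finset.prod_coe_sort T]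
  convert h using 1
  swap
  · exact Finset.prod_congr (by ext; simp) fun _ _ => rfl
  funext m
  obtain ⟨s, rfl⟩ := e.surjective m
  simp only [Function.comp_apply, Equiv.symm_apply_apply]
  rw [Finsupp.prod_of_support_subset s.1 (s := T) (by exact_mod_cast s.2) _ (by simp),
    ← Finset.prod_coe_sort T]
  rfl

theorem tendsto_prod_one_sub_inv {ι : Type*} (x : ι → 𝕜) (hx : ∀ b, ‖x b‖ < 1)
    (hs : Summable fun b => ‖x b‖) :
    Filter.Tendsto (fun T : Finset ι => ∏ b ∈ T, (1 - x b)⁻¹) Filter.atTop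
      (nhds (∏' b, (1 - x b))⁻¹) := by
  -- Inversion is continuous only away from `0`; the product converges absolutely and no factor
  -- vanishes since `‖x b‖ < 1`.
  have hne : ∏' b, (1 - x b) ≠ 0 := by
    simp only [sub_eq_add_neg]
    refine tprod_one_add_ne_zero_of_summable (fun b h => ?_) (by simpa using hs)
    have : x b = 1 := by linear_combination -h
    simpa [this] using hx b
  have hm : Multipliable fun b => 1 - x b := by
    simp only [sub_eq_add_neg]
    exact multipliable_one_add_of_summable (by simpa using hs)
  have h := hm.hasProd
  simp only [HasProd, SummationFilter.unconditional_filter] at h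
  simpa using h.inv₀ hne

omit [CompleteSpace 𝕜] in
-- A finite partial sum involves only the variables in the union `T` of the supports, so it is at
-- most `∏_{b ∈ T} (1 - ‖x b‖)⁻¹`. These products increase with `T` to a finite limit, which bounds
-- all partial sums.
theorem summable_norm_finsupp_prod {ι : Type*} (x : ι → 𝕜) (hx : ∀ b, ‖x b‖ < 1)
    (hs : Summable fun b => ‖x b‖) :
    Summable fun s : ι →₀ ℕ => ‖s.prod fun b k => x b ^ k‖ := by
  classical
  have hx' : ∀ b, ‖(‖x b‖ : ℝ)‖ < 1 := by simpa using hx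
  refine summable_of_sum_le (c := (∏' b, (1 - ‖x b‖))⁻¹) (fun _ => norm_nonneg _) fun F => ?_
  let T := F.biUnion Finsupp.support
  have hmono : Monotone fun T : Finset ι => ∏ b ∈ T, (1 - ‖x b‖)⁻¹ := by
    intro S T hST
    refine Finset.prod_le_prod_of_subset_of_one_le hST (fun b _ => ?_) fun b _ _ => ?_
    · exact inv_nonneg.2 (sub_nonneg.2 (hx b).le)
    · exact (one_le_inv₀ (sub_pos.2 (hx b))).2 (by simp)
  refine le_trans ?_ (hmono.ge_of_tendsto
    (tendsto_prod_one_sub_inv (fun b => ‖x b‖) hx' (by simpa using hs)) T)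
  have hsum := hasSum_finsupp_support_subset (fun b => ‖x b‖) hx' T
  refine le_trans (le_of_eq ?_) (sum_le_hasSum F (fun s _ => ?_) hsum)
  · refine Finset.sum_congr rfl fun s hsF => ?_
    rw [Set.indicator_of_mem]
    · simp [Finsupp.prod, norm_prod]
    · exact_mod_cast Finset.subset_biUnion_of_mem Finsupp.support hsF
  · exact Set.indicator_nonneg (fun s _ => Finset.prod_nonneg fun _ _ => by positivity) s

/-- The generating function of monomials: `∑ₛ xˢ = ∏_b (1 - x_b)⁻¹`. -/
theorem hasSum_finsupp_prod {ι : Type*} (x : ι → 𝕜) (hx : ∀ b, ‖x b‖ < 1)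
    (hs : Summable fun b => ‖x b‖) :
    HasSum (fun s : ι →₀ ℕ => s.prod fun b k => x b ^ k) (∏' b, (1 - x b))⁻¹ := by
  have hsum := summable_norm_finsupp_prod x hx hs
  rw [hsum.of_norm.hasSum_iff]
  refine tendsto_nhds_unique ?_ (tendsto_prod_one_sub_inv x hx hs)
  -- The sums over monomials supported in `T` are dominated by the full series of norms, and each
  -- indicator is eventually `1` as `T` grows.
  have h := tendsto_tsum_of_dominated_convergence (𝓕 := Filter.atTop) (f := fun T : Finset ι =>
    {s : ι →₀ ℕ | (s.support : Set ι) ⊆ T}.indicator fun s => s.prod fun b k => x b ^ k)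
    (g := fun s : ι →₀ ℕ => s.prod fun b k => x b ^ k) hsum (fun s => ?_)
    (Filter.Eventually.of_forall fun T s => norm_indicator_le_norm_self _ _)
  · simpa only [(hasSum_finsupp_support_subset x hx _).tsum_eq] using h
  · refine tendsto_const_nhds.congr' ?_
    filter_upwards [Filter.eventually_ge_atTop s.support] with T hT
    rw [Set.indicator_of_mem]
    exact_mod_cast hT

end Sums

/-! ### The operators `J(0)` and `L(0)` -/

theorem cocycle_zero_left (β : D28Plus) : cocycle 0 β = 1 := by
  have h := cocycle_add_left 0 0 β
  rwa [add_zero, left_eq_mul] at h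

theorem pairing_zero_left (β : D28Plus) : pairing 0 β = 0 := by
  simp [pairing, form]

theorem expCreation_zero : expCreation 0 = 1 := by
  have h : (PowerSeries.mk fun n : ℕ =>
      if h : 0 < n then
        ∑ i, MvPolynomial.C ((((0 : D28Plus).1 i : ℚ) : ℂ) / n) * MvPolynomial.X (i, ⟨n, h⟩)
      else (0 : Fock)) = 0 := by
    ext1 n
    simp
  rw [expCreation, h, PowerSeries.subst_zero_eq_C_constantCoeff]
  simp

theorem fieldCoeff_one (n : ℤ) : fieldCoeff n 1 = 1 := by
  simp [fieldCoeff]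

/-- For `α = 0` there is no translation: the map only merges the variables seen by annihilation
operators with those in the coefficients, which completes the normal ordering. -/
theorem expAnnihilation_zero_monomial (s : Osc →₀ ℕ) (r : LaurentSeries Fock) :
    expAnnihilation 0 (MvPolynomial.monomial s r) =
      r * HahnSeries.C (MvPolynomial.monomial s 1) := by
  have h : ∀ b : Osc, (HahnSeries.C (MvPolynomial.X b) -
      HahnSeries.single (-(b.2 : ℤ)) (MvPolynomial.C ((((0 : D28Plus).1 b.1 : ℚ) : ℂ))) :
        LaurentSeries Fock) = HahnSeries.C (MvPolynomial.X b) := fun b => by simp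
  rw [expAnnihilation]
  simp only [h]
  rw [MvPolynomial.aeval_monomial, MvPolynomial.monomial_eq, Finsupp.prod, Finsupp.prod, map_mul,
    map_prod]
  simp only [map_pow, map_one, one_mul, Algebra.algebraMap_self_apply]

theorem mode_single (n : ℤ) (α β : D28Plus) (s : Osc →₀ ℕ) (Q : Fock) :
    mode n (Finsupp.single α (MvPolynomial.monomial s 1)) (Finsupp.single β Q) =
      Finsupp.single (α + β) ((vertexMonomial α β s Q).coeff (-n - 1)) := by
  have h := (MvPolynomial.basisMonomials Osc ℂ).constr_basis ℂ (fun s =>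
    Finsupp.lsum ℂ fun β =>
      Finsupp.lsingle (α + β) ∘ₗ HahnSeries.coeff.linearMap (-n - 1) ∘ₗ vertexMonomial α β s) s
  rw [MvPolynomial.coe_basisMonomials] at h
  rw [mode, Finsupp.lsum_single, h, Finsupp.lsum_single]
  rfl

theorem vertexMonomial_zero (β : D28Plus) (s t : Osc →₀ ℕ) :
    vertexMonomial 0 β s (MvPolynomial.monomial t 1) =
      expAnnihilation 0 (orderedProduct β s (MvPolynomial.monomial t 1)) := by
  have h : (MvPolynomial.aeval (R := ℂ) fun b : Osc =>
      (MvPolynomial.X b : MvPolynomial Osc (LaurentSeries Fock)))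
      (MvPolynomial.monomial t 1) = MvPolynomial.monomial t 1 := by
    rw [MvPolynomial.aeval_monomial, MvPolynomial.monomial_eq]
    simp
  simp only [vertexMonomial, LinearMap.comp_apply, AlgHom.toLinearMap_apply, h,
    LinearMap.restrictScalars_apply, LinearMap.mulLeft_apply, expCreation_zero,
    cocycle_zero_left, pairing_zero_left]
  simp

theorem orderedProduct_single (β : D28Plus) (a : Osc) (n : ℕ) :
    orderedProduct β (Finsupp.single a n) = orderedField β a ^ n := by
  rw [orderedProduct, Multiset.noncommProd_eq_pow_card _ _ (orderedField β a)]
  · simp [Finsupp.toMultiset_single]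
  · intro x hx
    obtain ⟨b, hb, rfl⟩ := Multiset.mem_map.1 hx
    rw [Finsupp.mem_toMultiset, Finsupp.mem_support_iff, Finsupp.single_apply_ne_zero] at hb
    rw [hb.1]

/-- The result of applying `∑_{n>0} εᵢ(n) z^{-n-1}` to a monomial. -/
def annihilated (i : Fin 28) (s : Osc →₀ ℕ) : LaurentSeries Fock :=
  ∑ b ∈ s.support with b.1 = i, HahnSeries.single (-(b.2 : ℤ) - 1)
    (MvPolynomial.monomial (s - Finsupp.single b 1) ((s b : ℂ) * (b.2 : ℂ)))

theorem annihilationField_monomial (i : Fin 28) (s : Osc →₀ ℕ) (r : LaurentSeries Fock) :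
    annihilationField (i, 1) (MvPolynomial.monomial s r) =
      ∑ b ∈ s.support with b.1 = i, MvPolynomial.monomial (s - Finsupp.single b 1)
        (r * HahnSeries.single (-(b.2 : ℤ) - 1) (MvPolynomial.C ((s b : ℂ) * (b.2 : ℂ)))) := by
  rw [annihilationField, MvPolynomial.mkDerivation_monomial, Finsupp.sum, Finset.smul_sum,
    Finset.sum_filter]
  refine Finset.sum_congr rfl fun b _ => ?_
  split_ifs with h
  · rw [smul_eq_mul, mul_comm _ (MvPolynomial.C _), MvPolynomial.C_mul_monomial,
      MvPolynomial.smul_monomial, smul_eq_mul, fieldCoeff_one, one_mul]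
    congr 2
    -- The exponent brought down by differentiation is rewritten as a constant Laurent series so
    -- that it merges with the power of `z`.
    have : (s b : LaurentSeries Fock) = HahnSeries.single 0 (MvPolynomial.C (s b : ℂ)) := by
      rw [map_natCast]
      exact (map_natCast HahnSeries.C (s b)).symm
    rw [this, HahnSeries.single_mul_single, add_zero, ← MvPolynomial.C_mul, mul_comm (b.2 : ℂ)]
    simp
  · simp

theorem expAnnihilation_annihilationField (i : Fin 28) (s : Osc →₀ ℕ) (r : LaurentSeries Fock) :
    expAnnihilation 0 (annihilationField (i, 1) (MvPolynomial.monomial s r)) =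
      r * annihilated i s := by
  rw [annihilationField_monomial, map_sum, annihilated, Finset.mul_sum]
  refine Finset.sum_congr rfl fun b _ => ?_
  rw [expAnnihilation_zero_monomial, mul_assoc, HahnSeries.C_apply,
    HahnSeries.single_mul_single, add_zero, MvPolynomial.C_mul_monomial, mul_one]

/-- Annihilation operators `εᵢ(n)` with `n ≥ 1` come with `z^(-n-1)`, hence with exponents at most
`-2`. -/
theorem coeff_annihilated (i : Fin 28) (s : Osc →₀ ℕ) {k : ℤ} (hk : -1 ≤ k) :
    (annihilated i s).coeff k = 0 := by
  rw [annihilated, HahnSeries.coeff_sum]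
  refine Finset.sum_eq_zero fun b _ => HahnSeries.coeff_single_of_ne ?_
  have := b.2.pos
  omega

/-- Two annihilation operators contribute exponents at most `-4`, so they are invisible in the `z⁻²`
coefficient that defines `L 0`. -/
theorem coeff_annihilationField_sq (i : Fin 28) (s : Osc →₀ ℕ) {k : ℤ} (hk : -3 ≤ k) :
    (expAnnihilation 0 (annihilationField (i, 1)
      (annihilationField (i, 1) (MvPolynomial.monomial s 1)))).coeff k = 0 := by
  rw [annihilationField_monomial, map_sum, map_sum, HahnSeries.coeff_sum]
  refine Finset.sum_eq_zero fun b _ => ?_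
  rw [expAnnihilation_annihilationField, one_mul, HahnSeries.coeff_single_mul,
    coeff_annihilated, mul_zero]
  have := b.2.pos
  omega

/-- The part of `εᵢ(z)` acting on coefficients. -/
def multiplicationField (β : D28Plus) (i : Fin 28) : LaurentSeries Fock :=
  creationField (i, 1) + zeroModeField β (i, 1)

theorem orderedField_apply (β : D28Plus) (i : Fin 28)
    (P : MvPolynomial Osc (LaurentSeries Fock)) :
    orderedField β (i, 1) P = annihilationField (i, 1) P + multiplicationField β i • P := rfl

theorem coeff_creationField (i : Fin 28) (k : ℤ) :
    (creationField (i, 1)).coeff k =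
      if k < 0 then 0 else MvPolynomial.X (i, ⟨k.natAbs + 1, by positivity⟩) := by
  rw [creationField, PowerSeries.coeff_coe]
  simp [fieldCoeff_one, add_comm]

theorem zeroModeField_eq (β : D28Plus) (i : Fin 28) :
    zeroModeField β (i, 1) =
      HahnSeries.single (-1) (MvPolynomial.C ((β.1 i : ℚ) : ℂ)) := by
  simp [zeroModeField, fieldCoeff_one]

theorem coeff_multiplicationField_neg_one (β : D28Plus) (i : Fin 28) :
    (multiplicationField β i).coeff (-1) = MvPolynomial.C ((β.1 i : ℚ) : ℂ) := by
  simp [multiplicationField, coeff_creationField, zeroModeField_eq]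

theorem coeff_multiplicationField (β : D28Plus) (i : Fin 28) (n : ℕ+) :
    (multiplicationField β i).coeff ((n : ℤ) - 1) = MvPolynomial.X (i, n) := by
  have hn := n.pos
  have h : ¬ ((n : ℤ) - 1 < 0) := by omega
  rw [multiplicationField, HahnSeries.coeff_add, coeff_creationField, zeroModeField_eq,
    HahnSeries.coeff_single_of_ne (by omega), if_neg h, add_zero]
  congr 2
  refine PNat.eq ?_
  simp only [PNat.mk_coe]
  omega

/-- The creation part has only exponents `≥ 0`, so its square and its cross term with the zero mode
have exponents `≥ -1`; only the squared zero mode reaches `z⁻²`. -/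
theorem coeff_multiplicationField_sq (β : D28Plus) (i : Fin 28) :
    (multiplicationField β i ^ 2).coeff (-2) = MvPolynomial.C (((β.1 i : ℚ) : ℂ) ^ 2) := by
  have h : (creationField (i, 1) * creationField (i, 1)).coeff (-2) = 0 := by
    rw [creationField, ← map_mul, PowerSeries.coeff_coe]
    simp
  rw [multiplicationField, add_sq, sq (creationField _), mul_assoc, two_mul, zeroModeField_eq]
  simp only [HahnSeries.coeff_add, h, HahnSeries.coeff_mul_single, sq (HahnSeries.single _ _),
    HahnSeries.single_mul_single]
  simp [coeff_creationField, sq]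

/-- The exponent `-n-1` of `εᵢ(n)` is completed to `-2` exactly by `z^(n-1)`, whose coefficient is
`εᵢ(-n)`. This is the Euler operator: the variable removed by differentiation is put back. -/
theorem coeff_multiplicationField_mul_annihilated (β : D28Plus) (i : Fin 28) (s : Osc →₀ ℕ) :
    (multiplicationField β i * annihilated i s).coeff (-2) =
      MvPolynomial.monomial s (∑ b ∈ s.support with b.1 = i, (s b : ℂ) * (b.2 : ℂ)) := by
  rw [annihilated, Finset.mul_sum, HahnSeries.coeff_sum, map_sum]
  refine Finset.sum_congr rfl fun b hb => ?_
  obtain ⟨hb', rfl⟩ := Finset.mem_filter.1 hb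
  rw [HahnSeries.coeff_mul_single, show (-2 - (-(b.2 : ℤ) - 1) : ℤ) = b.2 - 1 by ring,
    coeff_multiplicationField, MvPolynomial.X, MvPolynomial.monomial_mul, one_mul,
    add_tsub_cancel_of_le]
  -- Subtraction of exponents is truncated, so restoring `s` needs `b` to occur in `s`.
  rw [Finsupp.single_le_iff]
  exact Nat.one_le_iff_ne_zero.2 (Finsupp.mem_support_iff.1 hb')

/-- The degree of a monomial. -/
def weight (s : Osc →₀ ℕ) : ℕ := s.sum fun b k => k * b.2

theorem J_zero_single (β : D28Plus) (s : Osc →₀ ℕ) :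
    J 0 (Finsupp.single β (MvPolynomial.monomial s 1)) =
      ((∑ i, β.1 i : ℚ) : ℂ) • Finsupp.single β (MvPolynomial.monomial s 1) := by
  have h : ∀ i, (vertexMonomial 0 β (Finsupp.single (i, 1) 1) (MvPolynomial.monomial s 1)).coeff
      (-0 - 1) = ((β.1 i : ℚ) : ℂ) • MvPolynomial.monomial s 1 := fun i => by
    rw [vertexMonomial_zero, orderedProduct_single, pow_one, orderedField_apply, map_add, map_smul,
      expAnnihilation_annihilationField, expAnnihilation_zero_monomial, HahnSeries.coeff_add,
      one_mul, one_mul, coeff_annihilated _ _ (by norm_num), smul_eq_mul, HahnSeries.C_apply,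
      HahnSeries.coeff_mul_single, zero_add, MvPolynomial.smul_eq_C_mul]
    congr 1
    exact coeff_multiplicationField_neg_one β i
  rw [J, current, Finsupp.single_finsetSum, map_sum, LinearMap.sum_apply]
  simp only [MvPolynomial.X, mode_single, h, zero_add]
  simp only [← Finsupp.smul_single, ← Finset.sum_smul]
  push_cast
  rfl

/-- Write `εᵢ(z) = A + M` with `A` the annihilation part and `M` acting on coefficients. As `A` is
linear over Laurent series, the normally ordered square is `A² + 2 M A + M²`. In degree `-2` these
give `0`, twice the weight in direction `i`, and `βᵢ²`. -/
theorem L_zero_single (β : D28Plus) (s : Osc →₀ ℕ) :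
    L 0 (Finsupp.single β (MvPolynomial.monomial s 1)) =
      ((weight s : ℂ) + ((form β β : ℚ) : ℂ) / 2) •
        Finsupp.single β (MvPolynomial.monomial s 1) := by
  have h : ∀ i, (vertexMonomial 0 β (Finsupp.single (i, 1) 2) (MvPolynomial.monomial s 1)).coeff
      (-(0 + 1) - 1) = (2 * (∑ b ∈ s.support with b.1 = i, (s b : ℂ) * (b.2 : ℂ)) +
        ((β.1 i : ℚ) : ℂ) ^ 2) • MvPolynomial.monomial s 1 := fun i => by
    rw [vertexMonomial_zero, orderedProduct_single, sq, Module.End.mul_apply,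
      orderedField_apply, orderedField_apply]
    simp only [map_add, map_smul, Derivation.map_smul, smul_add, expAnnihilation_annihilationField,
      expAnnihilation_zero_monomial, HahnSeries.coeff_add, smul_eq_mul, one_mul]
    rw [show (-(0 + 1) - 1 : ℤ) = -2 by norm_num, coeff_annihilationField_sq _ _ (by norm_num),
      coeff_multiplicationField_mul_annihilated, ← mul_assoc, ← sq, HahnSeries.C_apply,
      HahnSeries.coeff_mul_single, sub_zero, coeff_multiplicationField_sq,
      MvPolynomial.C_mul_monomial, MvPolynomial.smul_monomial, zero_add, ← add_assoc,
      ← map_add, ← map_add]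
    congr 1
    rw [smul_eq_mul]
    ring
  have hw : (weight s : ℂ) = ∑ i, ∑ b ∈ s.support with b.1 = i, (s b : ℂ) * (b.2 : ℂ) := by
    rw [Finset.sum_fiberwise, weight, Finsupp.sum]
    push_cast
    rfl
  have hc : conformal = (1 / 2 : ℂ) • ∑ i : Fin 28,
      Finsupp.single (0 : D28Plus) (MvPolynomial.monomial (Finsupp.single (i, 1) 2) 1) := by
    rw [conformal, ← MvPolynomial.smul_eq_C_mul, ← Finsupp.smul_single, Finsupp.single_finsetSum]
    simp only [MvPolynomial.X_pow_eq_monomial]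
  rw [L, hc, map_smul, map_sum, LinearMap.smul_apply, LinearMap.sum_apply]
  simp only [mode_single, h]
  simp only [zero_add, ← Finsupp.smul_single, ← Finset.sum_smul, smul_smul, Finset.sum_add_distrib,
    ← Finset.mul_sum, ← hw]
  congr 1
  rw [form]
  push_cast
  simp only [← sq]
  ring

/-! ### The decomposition into homogeneous subspaces -/

section Graded

variable {ι M K : Type*} [AddCommGroup M] [Module ℂ M]

/-- `T` is diagonal, so the eigenvalue equation can be read off one coordinate at a time. -/
theorem mem_eigenspace_iff_repr (b : Module.Basis ι ℂ M) (T : Module.End ℂ M) (l : ι → ℂ)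
    (hT : ∀ i, T (b i) = l i • b i) (μ : ℂ) (v : M) :
    v ∈ T.eigenspace μ ↔ ∀ i, b.repr v i ≠ 0 → l i = μ := by
  have h : ∀ i, b.repr (T v) i = l i * b.repr v i := fun i => by
    have : (Finsupp.lapply i ∘ₗ b.repr.toLinearMap) ∘ₗ T =
        l i • (Finsupp.lapply i ∘ₗ b.repr.toLinearMap) := by
      refine b.ext fun j => ?_
      by_cases hij : j = i
      · simp [hT, hij]
      · simp [hT, hij]
    exact LinearMap.congr_fun this v
  rw [Module.End.mem_eigenspace_iff, ← b.repr.injective.eq_iff, Finsupp.ext_iff]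
  refine forall_congr' fun i => ?_
  rw [h, map_smul, Finsupp.smul_apply, smul_eq_mul, mul_eq_mul_right_iff, ne_eq, or_comm,
    or_iff_not_imp_left]

/-- The span of the basis vectors of degree `k`. -/
def gradedPart (b : Module.Basis ι ℂ M) (g : ι → K) (k : K) : Submodule ℂ M :=
  (Finsupp.supported ℂ ℂ (g ⁻¹' {k})).comap b.repr.toLinearMap

theorem mem_gradedPart (b : Module.Basis ι ℂ M) (g : ι → K) (k : K) (v : M) :
    v ∈ gradedPart b g k ↔ ∀ i, b.repr v i ≠ 0 → g i = k := by
  rw [gradedPart, Submodule.mem_comap, Finsupp.mem_supported]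
  simp [Set.subset_def]

theorem isInternal_gradedPart [DecidableEq K] (b : Module.Basis ι ℂ M) (g : ι → K) :
    DirectSum.IsInternal (gradedPart b g) := by
  refine DirectSum.isInternal_submodule_of_iSupIndep_of_iSup_eq_top (fun k => ?_) ?_
  -- Independence: all the other parts together are supported off the fibre over `k`.
  · have h : ⨆ j, ⨆ (_ : j ≠ k), gradedPart b g j ≤
        (Finsupp.supported ℂ ℂ (g ⁻¹' {k})ᶜ).comap b.repr.toLinearMap := by
      refine iSup₂_le fun j hj => Submodule.comap_mono (Finsupp.supported_mono ?_)
      intro i hi hk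
      exact hj (hi.symm.trans hk)
    refine Disjoint.mono_right h (Submodule.disjoint_def.2 fun v hv hv' => ?_)
    have := Submodule.disjoint_def.1
      (Finsupp.disjoint_supported_supported (M := ℂ) (R := ℂ) disjoint_compl_right) _ hv hv'
    exact b.repr.map_eq_zero_iff.1 this
  · rw [eq_top_iff, ← b.span_eq, Submodule.span_le]
    rintro _ ⟨i, rfl⟩
    refine Submodule.mem_iSup_of_mem (g i) ((mem_gradedPart b g _ _).2 fun j hj => ?_)
    rw [b.repr_self, Finsupp.single_apply_ne_zero] at hj
    rw [hj.1]

/-- A graded part has the basis vectors of its degree as a basis. -/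
def gradedPartBasis (b : Module.Basis ι ℂ M) (g : ι → K) (k : K) :
    Module.Basis {i // g i = k} ℂ (gradedPart b g k) :=
  .ofRepr ((b.repr.submoduleMap _ ≪≫ₗ LinearEquiv.ofEq _ _
    (Submodule.map_comap_eq_of_surjective b.repr.surjective _)) ≪≫ₗ
      Finsupp.supportedEquivFinsupp (g ⁻¹' {k}))

end Graded

/-- The basis of `V` by the vectors `X^s ⊗ e^β`. -/
def monomialBasis : Module.Basis (Σ _ : D28Plus, Osc →₀ ℕ) ℂ V :=
  Finsupp.basis fun _ => MvPolynomial.basisMonomials Osc ℂ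

theorem monomialBasis_apply (x : Σ _ : D28Plus, Osc →₀ ℕ) :
    monomialBasis x = Finsupp.single x.1 (MvPolynomial.monomial x.2 1) := by
  rw [monomialBasis, Finsupp.coe_basis, MvPolynomial.coe_basisMonomials]

/-- The charge of `e^β`. -/
def charge (β : D28Plus) : ℤ := ⌊∑ i, β.1 i⌋

theorem charge_cast (β : D28Plus) : (charge β : ℚ) = ∑ i, β.1 i := by
  obtain ⟨k, hk⟩ := β.2.2
  rw [charge, hk]
  norm_cast

/-- The charge and twice the degree of `X^s ⊗ e^β`. -/
def bidegree (x : Σ _ : D28Plus, Osc →₀ ℕ) : ℤ × ℤ :=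
  (charge x.1, 2 * weight x.2 + pairing x.1 x.1)

theorem J_zero_monomialBasis (x : Σ _ : D28Plus, Osc →₀ ℕ) :
    J 0 (monomialBasis x) = ((bidegree x).1 : ℂ) • monomialBasis x := by
  rw [monomialBasis_apply, J_zero_single, ← charge_cast, Rat.cast_intCast, bidegree]

theorem L_zero_monomialBasis (x : Σ _ : D28Plus, Osc →₀ ℕ) :
    L 0 (monomialBasis x) = (((bidegree x).2 : ℂ) / 2) • monomialBasis x := by
  rw [monomialBasis_apply, L_zero_single, ← pairing_cast, Rat.cast_intCast, bidegree]
  congr 1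
  push_cast
  ring

/-- A joint eigenspace of two diagonal operators is spanned by the basis vectors with both
eigenvalues; integers embed in `ℂ`, so complex eigenvalues can be compared as a bidegree in `ℤ × ℤ`.
-/
theorem homogeneous_eq (m k : ℤ) :
    homogeneous m k = gradedPart monomialBasis bidegree (m, k) := by
  ext v
  rw [homogeneous, Submodule.mem_inf, mem_gradedPart,
    mem_eigenspace_iff_repr monomialBasis _ _ J_zero_monomialBasis,
    mem_eigenspace_iff_repr monomialBasis _ _ L_zero_monomialBasis, ← forall_and]
  refine forall_congr' fun i => ?_
  rw [← imp_and, Prod.ext_iff, Int.cast_inj, div_left_inj' two_ne_zero, Int.cast_inj]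

theorem commute_J_L : Commute (J 0) (L 0) := by
  refine monomialBasis.ext fun x => ?_
  simp only [Module.End.mul_apply, J_zero_monomialBasis, L_zero_monomialBasis, map_smul]
  rw [smul_comm]

/-! ### The character of the Fock space -/

theorem norm_exp_two_pi_I_mul_lt_one {τ : ℂ} (hτ : 0 < τ.im) :
    ‖exp (2 * Real.pi * I * τ)‖ < 1 := by
  simpa using UpperHalfPlane.norm_exp_two_pi_I_lt_one ⟨τ, hτ⟩

theorem hasSum_pow_weight {q : ℂ} (hq : ‖q‖ < 1) :
    HasSum (fun s : Osc →₀ ℕ => q ^ weight s) ((∏' n : ℕ, (1 - q ^ (n + 1))) ^ 28)⁻¹ := by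
  have hx : ∀ b : Osc, ‖q ^ (b.2 : ℕ)‖ < 1 := fun b => by
    rw [norm_pow]
    exact pow_lt_one₀ (norm_nonneg _) hq b.2.ne_zero
  have hs1 : Summable fun n : ℕ+ => ‖q‖ ^ (n : ℕ) :=
    (summable_geometric_of_lt_one (norm_nonneg _) hq).comp_injective PNat.coe_injective
  have hs : Summable fun b : Osc => ‖q ^ (b.2 : ℕ)‖ := by
    have h := (hasSum_fintype fun _ : Fin 28 => (1 : ℝ)).summable.mul_of_nonneg hs1
      (fun _ => zero_le_one) fun _ => by positivity
    simpa using h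
  have hp : HasProd (fun n : ℕ+ => 1 - q ^ (n : ℕ)) (∏' n : ℕ, (1 - q ^ (n + 1))) := by
    rw [← Equiv.pnatEquivNat.symm.hasProd_iff]
    simpa [Function.comp_def] using (ModularForm.multipliable_one_sub_pow hq).hasProd
  have hm : Multipliable fun b : Osc => 1 - q ^ (b.2 : ℕ) := by
    simp only [sub_eq_add_neg]
    exact multipliable_one_add_of_summable (by simpa using hs)
  -- Grouping the oscillators by direction gives one Euler product for each of the 28 directions.
  have ht : ∏' b : Osc, (1 - q ^ (b.2 : ℕ)) = (∏' n : ℕ, (1 - q ^ (n + 1))) ^ 28 := by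
    have h := (hm.hasProd.prod_fiberwise fun _ => hp).unique (hasProd_fintype _)
    simpa using h
  have h := hasSum_finsupp_prod (fun b : Osc => q ^ (b.2 : ℕ)) hx hs
  rw [ht] at h
  refine h.congr_fun fun s => ?_
  rw [weight, Finsupp.sum, ← Finset.prod_pow_eq_pow_sum, Finsupp.prod]
  exact Finset.prod_congr rfl fun b _ => by rw [← pow_mul, mul_comm]

/-! ### The theta series of the lattice -/

/-- Expanding the `n`-th power of the theta series gives a sum over `ℤⁿ`. Shifting `u` by `π / 2`
inserts the sign `(-1)^(∑ mᵢ)`, so the average of the two powers keeps exactly the even vectors. -/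
theorem hasSum_even_theta3 (u : ℂ) {τ : ℂ} (hτ : 0 < τ.im) (n : ℕ) :
    HasSum (fun m : {m : Fin n → ℤ | Even (∑ i, m i)} =>
        ∏ i, exp (2 * I * u * (m.1 i : ℤ) + Real.pi * I * τ * (m.1 i : ℤ) ^ 2))
      (1 / 2 * (theta3 u τ ^ n + theta3 (u + Real.pi / 2) τ ^ n)) := by
  have hπ : (Real.pi : ℂ) ≠ 0 := ofReal_ne_zero.2 Real.pi_ne_zero
  have hsum : ∀ u : ℂ, HasSum (fun m : Fin n → ℤ =>
      ∏ i, exp (2 * I * u * (m i : ℤ) + Real.pi * I * τ * (m i : ℤ) ^ 2)) (theta3 u τ ^ n) := by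
    intro u
    have h1 : Summable fun m : ℤ => exp (2 * I * u * m + Real.pi * I * τ * m ^ 2) := by
      refine ((summable_jacobiTheta₂_term_iff (u / Real.pi) τ).2 hτ).congr fun m => ?_
      rw [jacobiTheta₂_term]
      congr 1
      field_simp
    have h := hasSum_pi_prod (fun (_ : Fin n) (m : ℤ) =>
      exp (2 * I * u * m + Real.pi * I * τ * m ^ 2)) fun _ => h1.norm
    simpa [theta3] using h
  refine (hasSum_subtype_iff_indicator (f := fun m : Fin n → ℤ =>
    ∏ i, exp (2 * I * u * (m i : ℤ) + Real.pi * I * τ * (m i : ℤ) ^ 2))).2 ?_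
  refine (((hsum u).add (hsum (u + Real.pi / 2))).mul_left (1 / 2)).congr_fun fun m => ?_
  have hsign : ∏ i, exp (2 * I * (u + Real.pi / 2) * (m i : ℤ) +
      Real.pi * I * τ * (m i : ℤ) ^ 2) = (-1) ^ (∑ i, m i) *
      ∏ i, exp (2 * I * u * (m i : ℤ) + Real.pi * I * τ * (m i : ℤ) ^ 2) := by
    rw [← exp_pi_mul_I, ← exp_int_mul, ← exp_sum, ← exp_sum, ← exp_add]
    congr 1
    push_cast
    rw [Finset.sum_mul, ← Finset.sum_add_distrib]
    exact Finset.sum_congr rfl fun i _ => by ring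
  rw [hsign]
  by_cases hm : Even (∑ i, m i)
  · rw [Set.indicator_of_mem (show m ∈ {m : Fin n → ℤ | Even (∑ i, m i)} from hm),
      hm.neg_one_zpow]
    ring
  · rw [Set.indicator_of_notMem (show m ∉ {m : Fin n → ℤ | Even (∑ i, m i)} from hm),
      (Int.not_even_iff_odd.1 hm).neg_one_zpow]
    ring

/-- The even integer vectors. -/
abbrev EvenVector : Type := {m : Fin 28 → ℤ | Even (∑ i, m i)}

/-- The vector `m + (e, …, e) / 2`. -/
def shiftedVector (e : ℤ) (he : e = 0 ∨ e = 1) (m : EvenVector) : D28Plus :=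
  ⟨fun i => m.1 i + e / 2, by
    obtain ⟨k, hk⟩ := m.2
    -- The shift adds `28 · e / 2 = 14 e` to the coordinate sum, an even integer; so the coset keeps
    -- the same parity condition on `m`.
    refine ⟨?_, k + 7 * e, ?_⟩
    · rcases he with rfl | rfl
      · exact Or.inl fun i => ⟨m.1 i, by simp⟩
      · exact Or.inr fun i => ⟨m.1 i, by simp⟩
    · rw [Finset.sum_add_distrib, ← Int.cast_sum, hk]
      simp
      ring⟩

/-- The decomposition of `D₂₈⁺` into `D₂₈` and its spinor coset. -/
def evenVectorEquiv : EvenVector ⊕ EvenVector ≃ D28Plus :=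
  Equiv.ofBijective
    (Sum.elim (shiftedVector 0 (Or.inl rfl)) (shiftedVector 1 (Or.inr rfl))) <| by
    have hne : ∀ m n : EvenVector, shiftedVector 0 (Or.inl rfl) m ≠
        shiftedVector 1 (Or.inr rfl) n := fun m n h => by
      have h0 : ((m.1 0 : ℚ) + (0 : ℤ) / 2) = n.1 0 + (1 : ℤ) / 2 :=
        congrFun (congrArg Subtype.val h) 0
      have h1 : (2 * m.1 0 : ℚ) = 2 * n.1 0 + 1 := by push_cast at h0; linarith
      norm_cast at h1
      omega
    have hinj : ∀ e he, Function.Injective (shiftedVector e he) := fun e he m n h => by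
      refine Subtype.ext (funext fun i => ?_)
      have h0 : ((m.1 i : ℚ) + e / 2) = n.1 i + e / 2 := congrFun (congrArg Subtype.val h) i
      exact_mod_cast add_right_cancel h0
    refine ⟨(hinj _ _).sumElim (hinj _ _) hne, fun β => ?_⟩
    have hsurj : ∀ e he (m : Fin 28 → ℤ), (∀ i, β.1 i = m i + (e : ℤ) / 2) →
        ∃ n, shiftedVector e he n = β := fun e he m h => by
      refine ⟨⟨m, ?_⟩, Subtype.ext (funext fun i => (h i).symm)⟩
      obtain ⟨k, hk⟩ := β.2.2
      simp only [h, Finset.sum_add_distrib] at hk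
      refine ⟨k - 7 * e, ?_⟩
      have : ((∑ i, m i : ℤ) : ℚ) = ((k - 7 * e + (k - 7 * e) : ℤ) : ℚ) := by
        simp at hk
        push_cast
        linarith
      exact_mod_cast this
    rcases β.2.1 with h | h <;> choose m hm using h
    · obtain ⟨n, hn⟩ := hsurj 0 (Or.inl rfl) m (by simpa using hm)
      exact ⟨Sum.inl n, hn⟩
    · obtain ⟨n, hn⟩ := hsurj 1 (Or.inr rfl) m (by simpa using hm)
      exact ⟨Sum.inr n, hn⟩

/-- The theta series of `D₂₈⁺`. -/
theorem hasSum_lattice (z : ℂ) {τ : ℂ} (hτ : 0 < τ.im) :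
    HasSum (fun β : D28Plus => exp (2 * Real.pi * I * z * charge β) *
        exp (Real.pi * I * τ * pairing β β))
      (1 / 2 * (theta3 (Real.pi * z) τ ^ 28 + theta3 (Real.pi * z + Real.pi / 2) τ ^ 28) +
        exp (2 * Real.pi * I * z * 14) * exp (2 * Real.pi * I * τ * (7 / 2)) *
          (1 / 2 * (theta3 (Real.pi * z + Real.pi * τ / 2) τ ^ 28 +
            theta3 (Real.pi * z + Real.pi * τ / 2 + Real.pi / 2) τ ^ 28))) := by
  have hc : ∀ β : D28Plus, (charge β : ℂ) = ∑ i, ((β.1 i : ℚ) : ℂ) := fun β => by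
    have := congrArg (fun x : ℚ => (x : ℂ)) (charge_cast β)
    push_cast at this
    exact this
  have hp : ∀ β : D28Plus, (pairing β β : ℂ) = ∑ i, ((β.1 i : ℚ) : ℂ) ^ 2 := fun β => by
    have := congrArg (fun x : ℚ => (x : ℂ)) (pairing_cast β β)
    rw [form] at this
    push_cast at this
    simpa only [sq] using this
  have hval : ∀ β : D28Plus, exp (2 * Real.pi * I * z * charge β) *
      exp (Real.pi * I * τ * pairing β β) =
      ∏ i, exp (2 * Real.pi * I * z * ((β.1 i : ℚ) : ℂ) +
        Real.pi * I * τ * ((β.1 i : ℚ) : ℂ) ^ 2) := fun β => by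
    rw [hc, hp, ← exp_add, ← exp_sum, Finset.sum_add_distrib, Finset.mul_sum, Finset.mul_sum]
  simp only [hval]
  rw [← evenVectorEquiv.hasSum_iff]
  refine HasSum.sum ?_ ?_
  · refine (hasSum_even_theta3 (Real.pi * z) hτ 28).congr_fun fun m => ?_
    change ∏ i, exp (2 * Real.pi * I * z * (((m.1 i : ℚ) + (0 : ℤ) / 2 : ℚ) : ℂ) +
      Real.pi * I * τ * (((m.1 i : ℚ) + (0 : ℤ) / 2 : ℚ) : ℂ) ^ 2) = _
    refine Finset.prod_congr rfl fun i _ => ?_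
    congr 1
    push_cast
    ring
  · refine ((hasSum_even_theta3 (Real.pi * z + Real.pi * τ / 2) hτ 28).mul_left _).congr_fun
      fun m => ?_
    -- With `βᵢ = mᵢ + 1/2` one has `βᵢ² = mᵢ² + mᵢ + 1/4`. The linear term shifts the theta
    -- argument by `πτ / 2`, and each coordinate leaves a constant `exp(πiz + πiτ/4)`; the 28 of
    -- them make up `p^14 q^(7/2)`.
    have h28 : exp (2 * Real.pi * I * z * 14) * exp (2 * Real.pi * I * τ * (7 / 2)) =
        ∏ _i : Fin 28, exp (Real.pi * I * z + Real.pi * I * τ / 4) := by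
      rw [Finset.prod_const, ← exp_add, ← exp_nat_mul]
      congr 1
      simp
      ring
    change ∏ i, exp (2 * Real.pi * I * z * (((m.1 i : ℚ) + (1 : ℤ) / 2 : ℚ) : ℂ) +
      Real.pi * I * τ * (((m.1 i : ℚ) + (1 : ℤ) / 2 : ℚ) : ℂ) ^ 2) = _
    rw [h28, ← Finset.prod_mul_distrib]
    refine Finset.prod_congr rfl fun i _ => ?_
    rw [← exp_add]
    congr 1
    push_cast
    ring

/-! ### The character of `V` -/

theorem hasSum_mul_of_hasSum {ι κ : Type*} {g : ι → ℂ} {h : κ → ℂ} {a b : ℂ}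
    (ha : HasSum g a) (hb : HasSum h b) : HasSum (fun x : ι × κ => g x.1 * h x.2) (a * b) :=
  (summable_hasSum_mul ha.summable.norm hb.summable.norm ha hb).2

theorem hasSum_monomialBasis (z : ℂ) {τ : ℂ} (hτ : 0 < τ.im) :
    HasSum (fun x : Σ _ : D28Plus, Osc →₀ ℕ => exp (2 * Real.pi * I * z * (bidegree x).1) *
        exp (2 * Real.pi * I * τ * (((bidegree x).2 : ℂ) / 2 - 28 / 24)))
      (1 / 2 * (theta3 (Real.pi * z) τ ^ 28 / ModularForm.eta τ ^ 28 +
          theta3 (Real.pi * z + Real.pi / 2) τ ^ 28 / ModularForm.eta τ ^ 28) +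
        1 / 2 * exp (2 * Real.pi * I * z * 14) * exp (2 * Real.pi * I * τ * (7 / 2)) *
          (theta3 (Real.pi * z + Real.pi * τ / 2) τ ^ 28 / ModularForm.eta τ ^ 28 +
            theta3 (Real.pi * z + Real.pi * τ / 2 + Real.pi / 2) τ ^ 28 /
              ModularForm.eta τ ^ 28)) := by
  have h := (hasSum_mul_of_hasSum (hasSum_lattice z hτ)
    (hasSum_pow_weight (norm_exp_two_pi_I_mul_lt_one hτ))).mul_right
    (exp (2 * Real.pi * I * τ * (28 / 24)))⁻¹
  -- The prefactor `q^(1/24)` of `η`, to the power 28, accounts for the shift `-c/24` of the degree.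
  have hq : Function.Periodic.qParam 24 τ ^ 28 = exp (2 * Real.pi * I * τ * (28 / 24)) := by
    rw [Function.Periodic.qParam, ← exp_nat_mul]
    congr 1
    push_cast
    ring
  have heta : ModularForm.eta τ ^ 28 = exp (2 * Real.pi * I * τ * (28 / 24)) *
      (∏' n : ℕ, (1 - exp (2 * Real.pi * I * τ) ^ (n + 1))) ^ 28 := by
    rw [ModularForm.eta, mul_pow, hq]
    simp only [ModularForm.eta_q_eq_pow]
  rw [← (Equiv.sigmaEquivProd _ _).hasSum_iff] at h
  have hterm : ∀ x : Σ _ : D28Plus, Osc →₀ ℕ, exp (2 * Real.pi * I * z * (bidegree x).1) *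
      exp (2 * Real.pi * I * τ * (((bidegree x).2 : ℂ) / 2 - 28 / 24)) =
      exp (2 * Real.pi * I * z * charge x.1) * exp (Real.pi * I * τ * pairing x.1 x.1) *
        exp (2 * Real.pi * I * τ) ^ weight x.2 *
          (exp (2 * Real.pi * I * τ * (28 / 24)))⁻¹ := fun x => by
    simp only [bidegree, ← exp_nat_mul, ← exp_neg, ← exp_add]
    congr 1
    push_cast
    ring
  simp only [hterm, heta, div_eq_mul_inv (_ ^ 28 : ℂ), mul_inv]
  generalize theta3 (Real.pi * z) τ = a at h ⊢
  generalize theta3 (Real.pi * z + Real.pi / 2) τ = b at h ⊢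
  generalize theta3 (Real.pi * z + Real.pi * τ / 2) τ = c at h ⊢
  generalize theta3 (Real.pi * z + Real.pi * τ / 2 + Real.pi / 2) τ = d at h ⊢
  generalize ((∏' n : ℕ, (1 - exp (2 * Real.pi * I * τ) ^ (n + 1))) ^ 28)⁻¹ = p at h ⊢
  refine Eq.subst (motive := fun v => HasSum _ v) ?_ h
  ring

/-- Finiteness follows from convergence: at `z = 0`, `τ = i` the series over the basis is summable,
and its terms on one fibre are a constant nonzero number, which is impossible on an infinite fibre.
-/
theorem finite_bidegree_fiber (mk : ℤ × ℤ) :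
    Finite {x : Σ _ : D28Plus, Osc →₀ ℕ // bidegree x = mk} := by
  by_contra hinf
  rw [not_finite_iff_infinite] at hinf
  have h := (hasSum_monomialBasis 0 (τ := I) (by simp)).summable.comp_injective
    (Subtype.val_injective (p := fun x => bidegree x = mk))
  have hc : ∀ x : {x : Σ _ : D28Plus, Osc →₀ ℕ // bidegree x = mk}, bidegree x.1 = mk :=
    fun x => x.2
  simp only [Function.comp_def, hc, summable_const_iff] at h
  exact mul_ne_zero (exp_ne_zero _) (exp_ne_zero _) h

end LatticeSVOA

end


/-- The second index is twice the degree, hence the `mk.2 / 2`. `HasSum` is unconditional, which in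
`ℂ` amounts to absolute convergence. -/
theorem mainTheorem3 :
    (Commute (LatticeSVOA.J 0) (LatticeSVOA.L 0) ∧
      DirectSum.IsInternal (fun mk : ℤ × ℤ => LatticeSVOA.homogeneous mk.1 mk.2) ∧
      ∀ m k : ℤ, FiniteDimensional ℂ (LatticeSVOA.homogeneous m k)) ∧
    ∀ z τ : ℂ, 0 < τ.im →
      HasSum
        (fun mk : ℤ × ℤ => (Module.finrank ℂ (LatticeSVOA.homogeneous mk.1 mk.2) : ℂ) *
          Complex.exp (2 * Real.pi * Complex.I * z * mk.1) *
          Complex.exp (2 * Real.pi * Complex.I * τ * ((mk.2 : ℂ) / 2 - 28 / 24)))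
        (1 / 2 * (LatticeSVOA.theta3 (Real.pi * z) τ ^ 28 / ModularForm.eta τ ^ 28 +
            LatticeSVOA.theta3 (Real.pi * z + Real.pi / 2) τ ^ 28 / ModularForm.eta τ ^ 28) +
          1 / 2 * Complex.exp (2 * Real.pi * Complex.I * z * 14) *
            Complex.exp (2 * Real.pi * Complex.I * τ * (7 / 2)) *
            (LatticeSVOA.theta3 (Real.pi * z + Real.pi * τ / 2) τ ^ 28 / ModularForm.eta τ ^ 28 +
              LatticeSVOA.theta3 (Real.pi * z + Real.pi * τ / 2 + Real.pi / 2) τ ^ 28 /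
                ModularForm.eta τ ^ 28)) := by
  refine ⟨⟨LatticeSVOA.commute_J_L, ?_, fun m k => ?_⟩, fun z τ hτ => ?_⟩
  · simp only [LatticeSVOA.homogeneous_eq]
    exact LatticeSVOA.isInternal_gradedPart _ _
  · rw [LatticeSVOA.homogeneous_eq]
    have := LatticeSVOA.finite_bidegree_fiber (m, k)
    exact Module.Basis.finiteDimensional_of_finite
      (LatticeSVOA.gradedPartBasis LatticeSVOA.monomialBasis LatticeSVOA.bidegree (m, k))
  -- The sum over the basis is regrouped along the fibres of `bidegree`. Each fibre is finite with
  -- constant terms, and its cardinality is the dimension of the homogeneous space.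
  · refine ((Equiv.sigmaFiberEquiv LatticeSVOA.bidegree).hasSum_iff.2
      (LatticeSVOA.hasSum_monomialBasis z hτ)).sigma fun mk => ?_
    have := LatticeSVOA.finite_bidegree_fiber mk
    have := Fintype.ofFinite {x // LatticeSVOA.bidegree x = mk}
    rw [LatticeSVOA.homogeneous_eq, Module.finrank_eq_card_basis
      (LatticeSVOA.gradedPartBasis LatticeSVOA.monomialBasis LatticeSVOA.bidegree mk)]
    convert hasSum_fintype (β := {x // LatticeSVOA.bidegree x = mk}) _ using 1
    have hc : ∀ x : {x // LatticeSVOA.bidegree x = mk}, LatticeSVOA.bidegree x.1 = mk :=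
      fun x => x.2
    simp [Equiv.sigmaFiberEquiv, hc, mul_assoc]
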